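/- Let $K$ be a nonarchimedean local field of characteristic $0$ with absolute value $|\cdot|$, ring of integers $\mathcal{O}_K$ and residue field of characteristic $p$. Let $\overline{K}$ be an algebraic closure of $K$ with the unique extension of $|\cdot|$, and let $\mathbb{C}_v$ be its completion. Write $f^n$ for the $n$-th iterate of a polynomial $f$, with $f^0(z)=z$, and $f^{-n}(a)=\{x\in\overline{K} : f^n(x)=a\}$. The postcritical set of $f$ is $\{f^n(\gamma) : n\ge 0,\ f'(\gamma)=0\}$. Let $f\in\mathcal{O}_K[z]$ be a monic polynomial of degree $d$ with $p\mid d$ and $f(0)=0$, and suppose that $f$ is postcritically bounded, i.e. its postcritical set is bounded. Let $a\in\mathcal{O}_K$ avoid the postcritical set of $f$, i.e. suppose that there is $R>0$ such that the open disk $\{z\in\mathbb{C}_v : |z-a|<R\}$ contains no point of the postcritical set. Suppose moreover that $f^n(z)-a$ has $d^n$ distinct roots in $\overline{K}$ for every integer $n\ge 0$. Let $K_n=K(f^{-n}(a))$ and let $K_\infty$ be the union of the $K_n$. Then $K_\infty/K$ is infinitely wildly ramified: if $e(K_n/K)$ denotes the ramification index of $K_n/K$ and $v_p$ the $p$-adic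 valuation on $\mathbb{Q}$, then $v_p(e(K_n/K))\to\infty$ as $n\to\infty$. -/

import Mathlib

open Filter Polynomial

noncomputable section

namespace LocalArboreal

section Dynamics

/-- The set `f⁻ⁿ(a)` of all solutions `x` of `fⁿ(x) = a` in the field `L`. -/
def iteratedPreimage {L : Type*} [Field L] (f : L[X]) (a : L) (n : ℕ) : Set L :=
  {x | (fun z => f.eval z)^[n] x = a}

/-- The postcritical set `{fⁿ(γ) | n ≥ 0, γ ∈ L a critical point of f}`. It contains the critical
points themselves. -/
def postcriticalSet {L : Type*} [Field L] (f : L[X]) : Set L :=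
  {x | ∃ γ : L, f.derivative.eval γ = 0 ∧ ∃ n : ℕ, x = (fun z => f.eval z)^[n] γ}

/-- The point `a` avoids `X` if some open disk of positive radius centred at `a` is disjoint
from `X`. -/
def Avoids {L : Type*} [NormedField L] (a : L) (X : Set L) : Prop :=
  ∃ R : ℝ, 0 < R ∧ Disjoint (Metric.ball a R) X

end Dynamics

section Ramification

/-- The ring of integers `{x | ‖x‖ ≤ 1}` of a nonarchimedean field. -/
abbrev integers (K : Type*) [NormedField K] [IsUltrametricDist K] : ValuationSubring K :=
  (NormedField.valuation (K := K)).valuationSubring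

/-- The value group `|Fˣ|` of a normed field. -/
def valueGroup (F : Type*) [NormedField F] : Subgroup ℝˣ :=
  (Units.map (normHom : F →*₀ ℝ).toMonoidHom).range

/-- The ramification index `e(F/K) = [|Fˣ| : |Kˣ|]` of an extension of valued fields, where the
absolute value of `F` extends that of `K`. -/
def ramificationIndex (K F : Type*) [NormedField K] [NormedField F] : ℕ :=
  (valueGroup K).relIndex (valueGroup F)

end Ramification

section LocalField

variable (K : Type*) [NontriviallyNormedField K] [IsUltrametricDist K] [LocallyCompactSpace K]

/-- A locally compact nontrivially normed field is complete. -/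
instance instCompleteSpaceLocal : CompleteSpace K :=
  haveI : ProperSpace K := ProperSpace.of_locallyCompactSpace K
  inferInstance

/-- The algebraic closure of `K`, with the unique absolute value extending that of `K`. -/
instance instNormedFieldAlgClosure : NormedField (AlgebraicClosure K) :=
  spectralNorm.normedField K (AlgebraicClosure K)

/-- The completion `ℂ_v` of the algebraic closure of `K`. -/
abbrev CompletedAlgClosure : Type _ := UniformSpace.Completion (AlgebraicClosure K)

/-- The embedding of `K` into `ℂ_v`. -/
def toCompletedAlgClosure : K →+* CompletedAlgClosure K :=
  (UniformSpace.Completion.coeRingHom (α := AlgebraicClosure K)).comp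
    (algebraMap K (AlgebraicClosure K))

variable {K}

/-- `f` is postcritically bounded: the orbits in the algebraic closure of all critical points
stay in a common bounded set. -/
def PostcriticallyBounded (f : K[X]) : Prop :=
  Bornology.IsBounded (postcriticalSet (f.map (algebraMap K (AlgebraicClosure K))))

/-- The set `f⁻ⁿ(a)` in the algebraic closure of `K`. -/
def preimages (f : K[X]) (a : K) (n : ℕ) : Set (AlgebraicClosure K) :=
  iteratedPreimage (f.map (algebraMap K (AlgebraicClosure K)))
    (algebraMap K (AlgebraicClosure K) a) n

/-- The field `K_n = K(f⁻ⁿ(a))`. -/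
def preimageField (f : K[X]) (a : K) (n : ℕ) : IntermediateField K (AlgebraicClosure K) :=
  IntermediateField.adjoin K (preimages f a n)

/-- The union of a tower `F 0 ⊆ F 1 ⊆ ⋯` of finite extensions of `K` is infinitely wildly ramified
over `K`: the exponent of `p` in `e(F n / K)` tends to infinity. -/
def InfinitelyWildlyRamified (p : ℕ) (F : ℕ → IntermediateField K (AlgebraicClosure K)) : Prop :=
  Tendsto (fun n => padicValNat p (ramificationIndex K (F n))) atTop atTop

end LocalField

end LocalArboreal

end

/-!
The proof rests on the inseparability of `f` modulo `p`. A point outside the unit disk escapes to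
infinity, so the critical points of the postcritically bounded polynomial `f` are integral, and
`f' = d ∏ (X - γ)` is divisible by `d`, hence by `p`, among integral polynomials. The same then
holds for `f(y + X) - b` with `y` and `b` integral: its coefficients of index prime to `p` are
divisible by `p`. Wherever the Newton polygon of such a polynomial has a vertex with a coefficient
of absolute value greater than `|p|`, the index of that vertex is a multiple of `p`
(`dvd_card_of_prod_gt`).

Let `x, x'` lie in `f⁻ⁿ(a)` with `|p| < |x - x'|`, and let `f(y) = x`. Then `|x - x'|` is the
product of the absolute values of the roots of `f(y + X) - x'`, which are differences of two points
of `f⁻⁽ⁿ⁺¹⁾(a)`, and every absolute value occurs a multiple of `p` times. So `|x - x'|` is the `p`-th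
power of an element of `|K_{n+1}ˣ|`, and by induction the `pᵏ`-th power of an element of
`|K_{n+k}ˣ|` for every `k` (`IsInseparableMod.exists_norm_sub_eq_pow`).

A pair with `|p| < |x - x'| < 1` exists (`IsInseparableMod.exists_norm_natCast_lt_norm_sub`).
Indeed, the reduction of `f - a` has multiple roots, so two distinct points of `f⁻¹(a)` are
congruent; and going up one level at least halves the valuation of a suitable difference, since at
least two of the differences that multiply to `x - x'` lie in the open unit disk.

Finally `|Kˣ|` is infinite cyclic, so a fixed element other than `1` of `|K_nˣ|` that becomes a
`pᵏ`-th power in `|K_{n+k}ˣ|` for all `k` forces the exponent of `p` in `e(K_{n+k}/K)` to grow at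
least like `k` minus a constant (`exists_bound_of_pow_eq`).
-/

namespace LocalArboreal

/-! ### Newton polygons over ultrametric fields -/

section UltrametricPolynomials

variable {L : Type*} [NormedField L] [IsUltrametricDist L]

lemma norm_sub_le_max_norm (x y : L) : ‖x - y‖ ≤ max ‖x‖ ‖y‖ := by
  simpa [sub_eq_add_neg] using IsUltrametricDist.norm_add_le_max x (-y)

lemma norm_coeff_prod_X_sub_C_le {r : ℝ} (hr : 0 ≤ r) (A : Multiset L)
    (hA : ∀ a ∈ A, ‖a‖ ≤ r) (k j : ℕ) (hkj : k + j = A.card) :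
    ‖((A.map fun a => X - C a).prod).coeff k‖ ≤ r ^ j := by
  induction A using Multiset.induction_on generalizing k j with
  | empty =>
    have h0 : k = 0 ∧ j = 0 := by simpa using hkj
    simp [h0.1, h0.2]
  | cons a A ih =>
    have ih := ih fun b hb => hA b (Multiset.mem_cons_of_mem hb)
    have ha : ‖a‖ ≤ r := hA a (Multiset.mem_cons_self a A)
    rw [Multiset.card_cons] at hkj
    rw [Multiset.map_cons, Multiset.prod_cons, sub_mul]
    -- the summand `a * coeff k` is bounded whenever `k` does not exceed the degree of the tail
    have key : ‖a * ((A.map fun a => X - C a).prod).coeff k‖ ≤ r ^ j := by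
      rcases j with _ | j
      · rw [coeff_eq_zero_of_natDegree_lt, mul_zero, norm_zero]
        · positivity
        · rw [natDegree_multiset_prod_X_sub_C_eq_card]; omega
      · rw [norm_mul, pow_succ']
        exact mul_le_mul ha (ih k j (by omega)) (norm_nonneg _) hr
    rcases k with _ | k
    · simpa [mul_coeff_zero] using key
    · rw [coeff_sub, coeff_X_mul, coeff_C_mul]
      exact (norm_sub_le_max_norm _ _).trans (max_le (ih k j (by omega)) key)

omit [IsUltrametricDist L] in
lemma norm_coeff_zero_prod_X_sub_C (B : Multiset L) :
    ‖((B.map fun b => X - C b).prod).coeff 0‖ = (B.map norm).prod := by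
  induction B using Multiset.induction_on with
  | empty => simp
  | cons b B ih => simp [mul_coeff_zero, ih]

lemma norm_coeff_prod_X_sub_C_mul_pow_lt {r : ℝ} (hr : 0 ≤ r) (B : Multiset L)
    (hB : ∀ b ∈ B, r < ‖b‖) (k : ℕ) :
    ‖((B.map fun b => X - C b).prod).coeff (k + 1)‖ * r ^ (k + 1) < (B.map norm).prod := by
  induction B using Multiset.induction_on generalizing k with
  | empty => simp [coeff_one]
  | cons b B ih =>
    have ih := ih fun c hc => hB c (Multiset.mem_cons_of_mem hc)
    have hb : r < ‖b‖ := hB b (Multiset.mem_cons_self b B)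
    have hb0 : 0 < ‖b‖ := hr.trans_lt hb
    have hpos : 0 < (B.map norm).prod :=
      (mul_nonneg (norm_nonneg _) (pow_nonneg hr 1)).trans_lt (ih 0)
    rw [Multiset.map_cons, Multiset.prod_cons, Multiset.map_cons, Multiset.prod_cons, sub_mul,
      coeff_sub, coeff_X_mul, coeff_C_mul]
    set Q := (B.map fun b => X - C b).prod
    have h1 : ‖Q.coeff k‖ * r ^ (k + 1) < ‖b‖ * (B.map norm).prod := by
      have h : ‖Q.coeff k‖ * r ^ k ≤ (B.map norm).prod := by
        rcases k with _ | k
        · rw [pow_zero, mul_one, norm_coeff_zero_prod_X_sub_C]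
        · exact (ih k).le
      calc ‖Q.coeff k‖ * r ^ (k + 1) = r * (‖Q.coeff k‖ * r ^ k) := by ring
        _ ≤ r * (B.map norm).prod := by gcongr
        _ < ‖b‖ * (B.map norm).prod := by gcongr
    have h2 : ‖b * Q.coeff (k + 1)‖ * r ^ (k + 1) < ‖b‖ * (B.map norm).prod := by
      rw [norm_mul, mul_assoc]
      exact mul_lt_mul_of_pos_left (ih k) hb0
    calc _ ≤ max ‖Q.coeff k‖ ‖b * Q.coeff (k + 1)‖ * r ^ (k + 1) := by
          gcongr; exact norm_sub_le_max_norm _ _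
      _ = max (‖Q.coeff k‖ * r ^ (k + 1)) (‖b * Q.coeff (k + 1)‖ * r ^ (k + 1)) :=
          max_mul_of_nonneg _ _ (by positivity)
      _ < _ := max_lt h1 h2

/-- The vertices of a Newton polygon: if the roots of a monic polynomial are divided into `A` and
`B`, those in `A` being strictly smaller than those in `B`, then the coefficient of index `#A` has
the absolute value of the product of `B`. -/
lemma norm_coeff_card_prod_X_sub_C (A B : Multiset L) (hAB : ∀ a ∈ A, ∀ b ∈ B, ‖a‖ < ‖b‖) :
    ‖(((A + B).map fun a => X - C a).prod).coeff A.card‖ = (B.map norm).prod := by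
  classical
  rcases A.empty_or_exists_mem with rfl | ⟨a₀, ha₀⟩
  · simpa using norm_coeff_zero_prod_X_sub_C B
  obtain ⟨a, ha, hmax⟩ := A.toFinset.exists_max_image norm ⟨a₀, Multiset.mem_toFinset.2 ha₀⟩
  simp only [Multiset.mem_toFinset] at ha hmax
  have hB := norm_coeff_prod_X_sub_C_mul_pow_lt (norm_nonneg a) B (hAB a ha)
  have hA := norm_coeff_prod_X_sub_C_le (norm_nonneg a) A hmax
  rw [Multiset.map_add, Multiset.prod_add, coeff_mul,
    ← Finset.add_sum_erase (Finset.HasAntidiagonal.antidiagonal A.card) _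
      (Finset.HasAntidiagonal.mem_antidiagonal.2 (add_zero A.card) : (A.card, 0) ∈ _)]
  set P := (A.map fun a => X - C a).prod
  set Q := (B.map fun b => X - C b).prod
  have hP : P.coeff A.card = 1 := by
    have h := (monic_multiset_prod_of_monic A (fun a => X - C a)
      fun a _ => monic_X_sub_C a).coeff_natDegree
    rwa [natDegree_multiset_prod_X_sub_C_eq_card] at h
  have hQ : ‖Q.coeff 0‖ = (B.map norm).prod := norm_coeff_zero_prod_X_sub_C B
  have hpos : 0 < (B.map norm).prod :=
    (mul_nonneg (norm_nonneg _) (pow_nonneg (norm_nonneg a) 1)).trans_lt (hB 0)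
  have hlt : ‖∑ x ∈ (Finset.HasAntidiagonal.antidiagonal A.card).erase (A.card, 0),
      P.coeff x.1 * Q.coeff x.2‖ < ‖Q.coeff 0‖ := by
    rw [hQ]
    rcases ((Finset.HasAntidiagonal.antidiagonal A.card).erase
      (A.card, 0)).eq_empty_or_nonempty with h | h
    · simpa [h] using hpos
    obtain ⟨x, hx, hle⟩ := IsUltrametricDist.exists_norm_finsetSum_le_of_nonempty h
      fun x : ℕ × ℕ => P.coeff x.1 * Q.coeff x.2
    refine hle.trans_lt ?_
    obtain ⟨hx0, hx⟩ := Finset.mem_erase.1 hx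
    rw [Finset.HasAntidiagonal.mem_antidiagonal] at hx
    obtain ⟨i, j⟩ := x
    rcases j with _ | j
    · exact absurd (by simpa using hx) hx0
    rw [norm_mul, mul_comm]
    exact (mul_le_mul_of_nonneg_left (hA i (j + 1) hx) (norm_nonneg _)).trans_lt (hB j)
  rw [hP, one_mul, IsUltrametricDist.norm_add_eq_max_of_norm_ne_norm hlt.ne', max_eq_left hlt.le,
    hQ]

/-- Let the coefficients of a split monic polynomial be at most `c` in all degrees not divisible by
`p`. A vertex of the Newton polygon given by a coefficient of absolute value greater than `c` then
has an index divisible by `p`. -/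
lemma dvd_card_of_prod_gt {p : ℕ} {c : ℝ} {P : L[X]} (hP : P.Monic) (hs : P.Splits)
    (hc : ∀ k, ¬ p ∣ k → ‖P.coeff k‖ ≤ c) (A B : Multiset L) (hAB : A + B = P.roots)
    (hlt : ∀ a ∈ A, ∀ b ∈ B, ‖a‖ < ‖b‖) (hprod : c < (B.map norm).prod) : p ∣ A.card := by
  by_contra h
  have h1 := norm_coeff_card_prod_X_sub_C A B hlt
  rw [hAB, ← hs.eq_prod_roots_of_monic hP] at h1
  exact absurd (hc _ h) (by rw [h1]; exact not_le.2 hprod)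

omit [IsUltrametricDist L] in
lemma prod_map_norm_le_one (B : Multiset L) (hB : ∀ b ∈ B, ‖b‖ ≤ 1) : (B.map norm).prod ≤ 1 := by
  induction B using Multiset.induction_on with
  | empty => simp
  | cons b B ih =>
    rw [Multiset.map_cons, Multiset.prod_cons]
    exact mul_le_one₀ (hB b (Multiset.mem_cons_self b B))
      (Multiset.prod_nonneg (by simp +contextual))
      (ih fun c hc => hB c (Multiset.mem_cons_of_mem hc))

omit [IsUltrametricDist L] in
lemma prod_map_norm_eq_one (B : Multiset L) (hB : ∀ b ∈ B, ‖b‖ = 1) : (B.map norm).prod = 1 := by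
  rw [Multiset.map_congr rfl hB]; simp

omit [IsUltrametricDist L] in
lemma norm_coeff_zero_eq_prod_roots {P : L[X]} (hP : P.Monic) (hs : P.Splits) :
    ‖P.coeff 0‖ = (P.roots.map norm).prod := by
  conv_lhs => rw [hs.eq_prod_roots_of_monic hP]
  exact norm_coeff_zero_prod_X_sub_C _

/-- If the constant term exceeds `c`, then so does the coefficient at every vertex of the Newton
polygon, hence all its segments have length divisible by `p`: every absolute value is taken by a
multiple of `p` roots. -/
lemma dvd_count_norm_roots {p : ℕ} {c : ℝ} {P : L[X]} (hP : P.Monic) (hs : P.Splits)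
    (hc : ∀ k, ¬ p ∣ k → ‖P.coeff k‖ ≤ c) (hroots : ∀ u ∈ P.roots, ‖u‖ ≤ 1)
    (h0 : c < ‖P.coeff 0‖) (r : ℝ) : p ∣ (P.roots.map norm).count r := by
  classical
  have hbig (A B : Multiset L) (hAB : A + B = P.roots) : c < (B.map norm).prod := by
    refine h0.trans_le ?_
    rw [norm_coeff_zero_eq_prod_roots hP hs, ← hAB, Multiset.map_add, Multiset.prod_add]
    refine mul_le_of_le_one_left (Multiset.prod_nonneg (by simp +contextual))
      (prod_map_norm_le_one A fun a ha => hroots a ?_)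
    rw [← hAB]; exact Multiset.mem_add.2 (Or.inl ha)
  have hle : p ∣ (P.roots.filter (‖·‖ ≤ r)).card := by
    have h := Multiset.filter_add_not (fun u : L => ‖u‖ ≤ r) P.roots
    refine dvd_card_of_prod_gt hP hs hc _ _ h (fun a ha b hb => ?_) (hbig _ _ h)
    exact (Multiset.mem_filter.1 ha).2.trans_lt (not_le.1 (Multiset.mem_filter.1 hb).2)
  have hlt : p ∣ (P.roots.filter (‖·‖ < r)).card := by
    have h := Multiset.filter_add_not (fun u : L => ‖u‖ < r) P.roots
    refine dvd_card_of_prod_gt hP hs hc _ _ h (fun a ha b hb => ?_) (hbig _ _ h)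
    exact (Multiset.mem_filter.1 ha).2.trans_le (not_lt.1 (Multiset.mem_filter.1 hb).2)
  have hsum : (P.roots.filter (‖·‖ ≤ r)).card
      = (P.roots.filter (‖·‖ < r)).card + (P.roots.map norm).count r := by
    rw [Multiset.count_map, ← Multiset.card_add,
      ← Multiset.filter_add_not (fun u : L => ‖u‖ < r) (P.roots.filter (‖·‖ ≤ r)),
      Multiset.filter_filter, Multiset.filter_filter]
    congr 2
    · exact Multiset.filter_congr fun u _ => ⟨fun h => h.1, fun h => ⟨h, h.le⟩⟩
    · exact Multiset.filter_congr fun u _ => ⟨fun h => le_antisymm (not_lt.1 h.1) h.2,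
        fun h => ⟨not_lt.2 h.le, h.ge⟩⟩
  exact (Nat.dvd_add_right hlt).1 (hsum ▸ hle)

/-- If the constant term has absolute value less than `1`, then at least two roots lie in the open
unit disk, because their number is a positive multiple of `p`. -/
lemma two_le_card_roots_lt_one {p : ℕ} (hp : 2 ≤ p) {c : ℝ} (hc1 : c < 1) {P : L[X]} (hP : P.Monic)
    (hs : P.Splits) (hc : ∀ k, ¬ p ∣ k → ‖P.coeff k‖ ≤ c) (hroots : ∀ u ∈ P.roots, ‖u‖ ≤ 1)
    (h0 : ‖P.coeff 0‖ < 1) : 2 ≤ (P.roots.filter (‖·‖ < 1)).card := by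
  have h := Multiset.filter_add_not (fun u : L => ‖u‖ < 1) P.roots
  have hone : ((P.roots.filter (¬ ‖·‖ < 1)).map norm).prod = 1 :=
    prod_map_norm_eq_one _ fun b hb => le_antisymm (hroots b (Multiset.mem_filter.1 hb).1)
      (not_lt.1 (Multiset.mem_filter.1 hb).2)
  have hdvd : p ∣ (P.roots.filter (‖·‖ < 1)).card :=
    dvd_card_of_prod_gt hP hs hc _ _ h (fun a ha b hb => (Multiset.mem_filter.1 ha).2.trans_le
      (not_lt.1 (Multiset.mem_filter.1 hb).2)) (hc1.trans_eq hone.symm)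
  have hne : (P.roots.filter (‖·‖ < 1)).card ≠ 0 := by
    intro h'
    rw [norm_coeff_zero_eq_prod_roots hP hs, ← h, Multiset.card_eq_zero.1 h', zero_add, hone] at h0
    exact h0.false
  exact hp.trans (Nat.le_of_dvd (Nat.pos_of_ne_zero hne) hdvd)

lemma norm_eval_le {P : L[X]} {c : ℝ} (hc : 0 ≤ c) (hint : ∀ k, ‖P.coeff k‖ ≤ c) {u : L}
    (hu : ‖u‖ ≤ 1) : ‖P.eval u‖ ≤ c := by
  rw [eval_eq_sum_range]
  refine IsUltrametricDist.norm_sum_le_of_forall_le_of_nonneg hc fun i _ => ?_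
  rw [norm_mul, norm_pow]
  exact (mul_le_of_le_one_right (norm_nonneg _) (pow_le_one₀ (norm_nonneg _) hu)).trans (hint i)

lemma norm_coeff_taylor_le {P : L[X]} {c : ℝ} (hc : 0 ≤ c) (hint : ∀ k, ‖P.coeff k‖ ≤ c) {u : L}
    (hu : ‖u‖ ≤ 1) (k : ℕ) : ‖(taylor u P).coeff k‖ ≤ c := by
  rw [taylor_coeff]
  refine norm_eval_le hc (fun i => ?_) hu
  rw [hasseDeriv_coeff, norm_mul]
  exact (mul_le_of_le_one_left (norm_nonneg _) (IsUltrametricDist.norm_natCast_le_one L _)).trans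
    (hint _)

/-- Outside the unit disk the leading term of a monic integral polynomial dominates. -/
lemma norm_eval_eq_pow {P : L[X]} (hP : P.Monic) (hint : ∀ k, ‖P.coeff k‖ ≤ 1) {u : L}
    (hu : 1 < ‖u‖) : ‖P.eval u‖ = ‖u‖ ^ P.natDegree := by
  rw [eval_eq_sum_range, Finset.sum_range_succ, hP.coeff_natDegree, one_mul, add_comm]
  have hlt : ‖∑ i ∈ Finset.range P.natDegree, P.coeff i * u ^ i‖ < ‖u ^ P.natDegree‖ := by
    rcases (Finset.range P.natDegree).eq_empty_or_nonempty with h | h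
    · rw [h, Finset.sum_empty, norm_zero, norm_pow]; positivity
    obtain ⟨i, hi, hle⟩ := IsUltrametricDist.exists_norm_finsetSum_le_of_nonempty h
      fun i => P.coeff i * u ^ i
    refine hle.trans_lt ?_
    rw [norm_mul, norm_pow, norm_pow]
    exact (mul_le_of_le_one_left (by positivity) (hint i)).trans_lt
      (pow_lt_pow_right₀ hu (Finset.mem_range.1 hi))
  rw [IsUltrametricDist.norm_add_eq_max_of_norm_ne_norm hlt.ne', max_eq_left hlt.le, norm_pow]

end UltrametricPolynomials

/-! ### Differences of iterated preimages -/

section PreimageDifferences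

variable {L : Type*} [NormedField L] [IsUltrametricDist L]

lemma norm_iterate_eval {f : L[X]} (hf : f.Monic) (hint : ∀ k, ‖f.coeff k‖ ≤ 1)
    (hdeg : f.natDegree ≠ 0) {x : L} (hx : 1 < ‖x‖) (n : ℕ) :
    ‖(fun z => f.eval z)^[n] x‖ = ‖x‖ ^ f.natDegree ^ n := by
  induction n with
  | zero => simp
  | succ n ih =>
    rw [Function.iterate_succ_apply', norm_eval_eq_pow hf hint, ih, ← pow_mul, ← pow_succ]
    rw [ih]
    exact one_lt_pow₀ hx (pow_ne_zero n hdeg)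

/-- Points outside the unit disk escape to infinity, so the critical points of a postcritically
bounded polynomial are integral. -/
lemma norm_critical_le_one {f : L[X]} (hf : f.Monic) (hint : ∀ k, ‖f.coeff k‖ ≤ 1)
    (hdeg : 2 ≤ f.natDegree) (hb : Bornology.IsBounded (postcriticalSet f)) {γ : L}
    (hγ : f.derivative.eval γ = 0) : ‖γ‖ ≤ 1 := by
  by_contra h
  have h1 : 1 < ‖γ‖ := not_le.1 h
  obtain ⟨M, hM⟩ := hb.exists_norm_le
  obtain ⟨n, hn⟩ := pow_unbounded_of_one_lt M h1
  have h2 := hM _ ⟨γ, hγ, n, rfl⟩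
  rw [norm_iterate_eval hf hint (by omega) h1] at h2
  exact absurd (h2.trans_lt hn)
    (not_lt.2 (pow_le_pow_right₀ h1.le (Nat.lt_pow_self (by omega)).le))

lemma norm_iteratedPreimage_le_one {f : L[X]} (hf : f.Monic) (hint : ∀ k, ‖f.coeff k‖ ≤ 1)
    (hdeg : f.natDegree ≠ 0) {a : L} (ha : ‖a‖ ≤ 1) {n : ℕ} {x : L}
    (hx : x ∈ iteratedPreimage f a n) : ‖x‖ ≤ 1 := by
  by_contra h
  have h1 := norm_iterate_eval hf hint hdeg (not_le.1 h) n
  rw [show (fun z => f.eval z)^[n] x = a from hx] at h1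
  exact absurd ha (not_le.2 (h1 ▸ one_lt_pow₀ (not_le.1 h) (pow_ne_zero n hdeg)))

/-- If all critical points of `f` are integral then `f'` is divisible by its leading coefficient
among integral polynomials. -/
lemma norm_coeff_derivative_le [IsAlgClosed L] {f : L[X]}
    (hcrit : ∀ γ, f.derivative.eval γ = 0 → ‖γ‖ ≤ 1) (k : ℕ) :
    ‖f.derivative.coeff k‖ ≤ ‖f.derivative.leadingCoeff‖ := by
  by_cases h0 : f.derivative = 0
  · simp [h0]
  rw [(IsAlgClosed.splits f.derivative).eq_prod_roots, coeff_C_mul, norm_mul]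
  have h1 : ‖((f.derivative.roots.map fun a => X - C a).prod).coeff k‖ ≤ 1 := by
    rcases le_or_gt k f.derivative.roots.card with hk | hk
    · obtain ⟨j, hj⟩ := Nat.exists_eq_add_of_le hk
      simpa using norm_coeff_prod_X_sub_C_le zero_le_one f.derivative.roots
        (fun a ha => hcrit a ((mem_roots h0).1 ha)) k j hj.symm
    · rw [coeff_eq_zero_of_natDegree_lt (by rwa [natDegree_multiset_prod_X_sub_C_eq_card])]
      simp
  refine (mul_le_of_le_one_right (norm_nonneg _) h1).trans (le_of_eq ?_)
  rw [← (IsAlgClosed.splits f.derivative).eq_prod_roots]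

lemma norm_natCast_eq_one {p : ℕ} (hp : p.Prime) (hp1 : ‖(p : L)‖ < 1) {k : ℕ} (hk : ¬ p ∣ k) :
    ‖(k : L)‖ = 1 := by
  refine le_antisymm (IsUltrametricDist.norm_natCast_le_one L k) (not_lt.1 fun hlt => ?_)
  obtain ⟨u, v, huv⟩ := Nat.isCoprime_iff_coprime.2 ((hp.coprime_iff_not_dvd).2 hk)
  have h1 : (u : L) * p + v * k = 1 := by exact_mod_cast congrArg (Int.cast : ℤ → L) huv
  have h2 := IsUltrametricDist.norm_add_le_max ((u : L) * p) (v * k)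
  rw [h1, norm_one, norm_mul, norm_mul] at h2
  have hu := IsUltrametricDist.norm_intCast_le_one L u
  have hv := IsUltrametricDist.norm_intCast_le_one L v
  refine absurd h2 (not_le.2 (max_lt ?_ ?_))
  · exact (mul_le_of_le_one_left (norm_nonneg _) hu).trans_lt hp1
  · exact (mul_le_of_le_one_left (norm_nonneg _) hv).trans_lt hlt

/-- The class of polynomials to which the argument applies: monic and integral of positive degree,
with a derivative that vanishes modulo `p`. -/
structure IsInseparableMod (p : ℕ) (f : L[X]) : Prop where
  monic : f.Monic
  natDegree_ne_zero : f.natDegree ≠ 0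
  norm_coeff_le_one : ∀ k, ‖f.coeff k‖ ≤ 1
  norm_coeff_derivative_le : ∀ k, ‖f.derivative.coeff k‖ ≤ ‖(p : L)‖

/-- A postcritically bounded monic integral polynomial of degree divisible by `p` is inseparable
modulo `p`, because its derivative is divisible by its degree. -/
lemma isInseparableMod_of_isBounded [IsAlgClosed L] [CharZero L] {p : ℕ} (hp : p.Prime) {f : L[X]}
    (hf : f.Monic) (hint : ∀ k, ‖f.coeff k‖ ≤ 1) (hpd : p ∣ f.natDegree)
    (hd0 : f.natDegree ≠ 0) (hb : Bornology.IsBounded (postcriticalSet f)) :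
    IsInseparableMod p f := by
  refine ⟨hf, hd0, hint, fun k => ?_⟩
  have hd2 : 2 ≤ f.natDegree := hp.two_le.trans (Nat.le_of_dvd (Nat.pos_of_ne_zero hd0) hpd)
  refine (norm_coeff_derivative_le (fun γ hγ => norm_critical_le_one hf hint hd2 hb hγ) k).trans ?_
  rw [leadingCoeff_derivative, hf.leadingCoeff, one_mul]
  obtain ⟨m, hm⟩ := hpd
  rw [hm, Nat.cast_mul, norm_mul]
  exact mul_le_of_le_one_right (norm_nonneg _) (IsUltrametricDist.norm_natCast_le_one L m)

omit [IsUltrametricDist L] in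
lemma mem_iteratedPreimage_succ {f : L[X]} {a x : L} {n : ℕ} :
    x ∈ iteratedPreimage f a (n + 1) ↔ f.eval x ∈ iteratedPreimage f a n := Iff.rfl

/-- The polynomial `f(y + X) - b`, whose roots are the differences `x - y` with `f(x) = b`. -/
noncomputable def differencePoly (f : L[X]) (y b : L) : L[X] := taylor y f - C b

omit [IsUltrametricDist L] in
lemma coeff_zero_differencePoly (f : L[X]) (y b : L) :
    (differencePoly f y b).coeff 0 = f.eval y - b := by
  simp [differencePoly]

namespace IsInseparableMod

variable {p : ℕ} {f : L[X]} (h : IsInseparableMod p f) {y b : L}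

include h

omit [IsUltrametricDist L] in
lemma monic_differencePoly : (differencePoly f y b).Monic := by
  refine Monic.sub_of_left ?_ ?_
  · rw [Monic, leadingCoeff_taylor]; exact h.monic
  · refine degree_C_le.trans_lt ?_
    rw [degree_taylor, ← natDegree_pos_iff_degree_pos]
    exact Nat.pos_of_ne_zero h.natDegree_ne_zero

omit [IsUltrametricDist L] in
lemma mem_roots_differencePoly {u : L} :
    u ∈ (differencePoly f y b).roots ↔ f.eval (y + u) = b := by
  rw [mem_roots h.monic_differencePoly.ne_zero, IsRoot.def, differencePoly, eval_sub, eval_C,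
    taylor_eval, sub_eq_zero, add_comm]

lemma norm_coeff_differencePoly_le (hp : p.Prime) (hp1 : ‖(p : L)‖ < 1) (hy : ‖y‖ ≤ 1) {k : ℕ}
    (hk : ¬ p ∣ k) : ‖(differencePoly f y b).coeff k‖ ≤ ‖(p : L)‖ := by
  obtain ⟨k, rfl⟩ := Nat.exists_eq_succ_of_ne_zero (fun h0 => hk (h0 ▸ dvd_zero p) : k ≠ 0)
  have h1 : derivative (differencePoly f y b) = taylor y f.derivative := by
    simp [differencePoly, taylor_apply, derivative_comp]
  have h2 : ‖(derivative (differencePoly f y b)).coeff k‖ ≤ ‖(p : L)‖ := by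
    rw [h1]
    exact norm_coeff_taylor_le (norm_nonneg _) h.norm_coeff_derivative_le hy k
  have h3 : ‖((k + 1 : ℕ) : L)‖ = 1 := norm_natCast_eq_one hp hp1 hk
  rw [coeff_derivative, norm_mul] at h2
  rw [Nat.cast_add_one] at h3
  rwa [h3, mul_one] at h2

lemma norm_le_one {a x : L} (ha : ‖a‖ ≤ 1) {n : ℕ} (hx : x ∈ iteratedPreimage f a n) : ‖x‖ ≤ 1 :=
  norm_iteratedPreimage_le_one h.monic h.norm_coeff_le_one h.natDegree_ne_zero ha hx

omit [IsUltrametricDist L] in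
lemma add_mem_iteratedPreimage {a u : L} {n : ℕ} (hb : b ∈ iteratedPreimage f a n)
    (hu : u ∈ (differencePoly f y b).roots) : y + u ∈ iteratedPreimage f a (n + 1) :=
  mem_iteratedPreimage_succ.2 ((h.mem_roots_differencePoly.1 hu).symm ▸ hb)

lemma norm_le_one_of_mem_roots {a : L} (ha : ‖a‖ ≤ 1) {n : ℕ}
    (hy : y ∈ iteratedPreimage f a (n + 1)) (hb : b ∈ iteratedPreimage f a n) :
    ∀ u ∈ (differencePoly f y b).roots, ‖u‖ ≤ 1 := fun u hu => by
  have hle := norm_sub_le_max_norm (y + u) y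
  rw [add_sub_cancel_left] at hle
  exact hle.trans (max_le (h.norm_le_one ha (h.add_mem_iteratedPreimage hb hu))
    (h.norm_le_one ha hy))

omit [IsUltrametricDist L] in
lemma norm_eval_sub_eq_prod_roots [IsAlgClosed L] :
    ‖f.eval y - b‖ = ((differencePoly f y b).roots.map norm).prod := by
  rw [← norm_coeff_zero_eq_prod_roots h.monic_differencePoly (IsAlgClosed.splits _),
    coeff_zero_differencePoly]

end IsInseparableMod

omit [IsUltrametricDist L] in
lemma prod_map_norm_le_of_mem {B : Multiset L} (hB : ∀ b ∈ B, ‖b‖ ≤ 1) {u : L} (hu : u ∈ B) :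
    (B.map norm).prod ≤ ‖u‖ := by
  obtain ⟨B, rfl⟩ := Multiset.exists_cons_of_mem hu
  rw [Multiset.map_cons, Multiset.prod_cons]
  exact mul_le_of_le_one_right (norm_nonneg _)
    (prod_map_norm_le_one B fun b hb => hB b (Multiset.mem_cons_of_mem hb))

/-- If all multiplicities in a multiset of elements of `S` are divisible by `p`, then its product is
the `p`-th power of an element of `S`. -/
lemma exists_pow_eq_prod {p : ℕ} (S : Submonoid ℝ) (T : Multiset ℝ) (hT : ∀ r ∈ T, r ∈ S)
    (hcount : ∀ r, p ∣ T.count r) : ∃ s ∈ S, T.prod = s ^ p := by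
  choose m hm using hcount
  refine ⟨∏ r ∈ T.toFinset, r ^ m r,
    S.prod_mem fun r hr => S.pow_mem (hT r (Multiset.mem_toFinset.1 hr)) _, ?_⟩
  rw [Finset.prod_multiset_count, ← Finset.prod_pow]
  exact Finset.prod_congr rfl fun r _ => by rw [hm, mul_comm, pow_mul]

/-- The key step: if two points of `f⁻ⁿ(a)` are at distance greater than `|p|`, then their distance
becomes a `pᵏ`-th power in the value group of any field containing `f⁻⁽ⁿ⁺ᵏ⁾(a)`. It is the product
of the distances from one preimage of the first point to all preimages of the second, and each of
these distances occurs a multiple of `p` times. -/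
lemma IsInseparableMod.exists_norm_sub_eq_pow [IsAlgClosed L] {p : ℕ} {f : L[X]}
    (h : IsInseparableMod p f) (hp : p.Prime) (hp1 : ‖(p : L)‖ < 1) {a : L} (ha : ‖a‖ ≤ 1)
    (F : ℕ → Subfield L) (hF : ∀ n, iteratedPreimage f a n ⊆ F n) (k : ℕ) :
    ∀ (n : ℕ) (x x' : L), x ∈ iteratedPreimage f a n → x' ∈ iteratedPreimage f a n →
      ‖(p : L)‖ < ‖x - x'‖ → ∃ z ∈ F (n + k), ‖x - x'‖ = ‖z‖ ^ p ^ k := by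
  induction k with
  | zero =>
    intro n x x' hx hx' _
    exact ⟨x - x', (F n).sub_mem (hF n hx) (hF n hx'), by simp⟩
  | succ k ih =>
    intro n x x' hx hx' hlt
    obtain ⟨y, hy⟩ : ∃ y, f.eval y = x := IsAlgClosed.eval_surjective h.natDegree_ne_zero x
    have hyn : y ∈ iteratedPreimage f a (n + 1) := mem_iteratedPreimage_succ.2 (hy.symm ▸ hx)
    have hy1 := h.norm_le_one ha hyn
    have hu1 := h.norm_le_one_of_mem_roots ha hyn hx'
    have hprod := h.norm_eval_sub_eq_prod_roots (y := y) (b := x')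
    rw [hy] at hprod
    -- the absolute values of `pᵏ`-th powers in the field of level `n + 1 + k`
    let S : Submonoid ℝ :=
      (((F (n + 1 + k)).toSubmonoid.map (normHom : L →*₀ ℝ))).map (powMonoidHom (p ^ k))
    obtain ⟨s, hs, hsp⟩ := exists_pow_eq_prod S ((differencePoly f y x').roots.map norm)
      (fun r hr => by
        obtain ⟨u, hu, rfl⟩ := Multiset.mem_map.1 hr
        obtain ⟨z, hz, hzu⟩ := ih (n + 1) (y + u) y (h.add_mem_iteratedPreimage hx' hu) hyn (by
          rw [add_sub_cancel_left]
          exact hlt.trans_le (hprod.trans_le (prod_map_norm_le_of_mem hu1 hu)))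
        rw [add_sub_cancel_left] at hzu
        exact ⟨‖z‖, ⟨z, hz, rfl⟩, hzu.symm⟩)
      (dvd_count_norm_roots h.monic_differencePoly (IsAlgClosed.splits _)
        (fun k hk => h.norm_coeff_differencePoly_le hp hp1 hy1 hk) hu1
        (by rwa [coeff_zero_differencePoly, hy]))
    obtain ⟨_, ⟨z, hz, rfl⟩, rfl⟩ := hs
    refine ⟨z, by rwa [add_assoc, add_comm 1 k] at hz, ?_⟩
    rw [hprod, hsp, pow_succ, pow_mul]
    rfl

/-- Two distinct preimages of `a` that are congruent modulo the maximal ideal exist because `f` is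
inseparable modulo `p`. -/
lemma IsInseparableMod.exists_norm_sub_lt_one [IsAlgClosed L] {p : ℕ} {f : L[X]}
    (h : IsInseparableMod p f) (hp : p.Prime) (hp1 : ‖(p : L)‖ < 1) {a : L} (ha : ‖a‖ ≤ 1)
    (hcard : (iteratedPreimage f a 1).ncard = f.natDegree) :
    ∃ x ∈ iteratedPreimage f a 1, ∃ x' ∈ iteratedPreimage f a 1, 0 < ‖x - x'‖ ∧ ‖x - x'‖ < 1 := by
  classical
  obtain ⟨y, hy⟩ : ∃ y, f.eval y = a := IsAlgClosed.eval_surjective h.natDegree_ne_zero a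
  have hy1 : ‖y‖ ≤ 1 := h.norm_le_one ha (n := 1) hy
  obtain ⟨P, hP⟩ : ∃ P, P = differencePoly f y a := ⟨_, rfl⟩
  have hmem : ∀ {u}, u ∈ P.roots ↔ y + u ∈ iteratedPreimage f a 1 :=
    hP ▸ h.mem_roots_differencePoly
  have hnodup : P.roots.Nodup := by
    rw [← Multiset.toFinset_card_eq_card_iff_nodup]
    refine le_antisymm (Multiset.toFinset_card_le _) ?_
    have himage : (y + ·) '' (P.roots.toFinset : Set L) = iteratedPreimage f a 1 := by
      ext x
      simp only [Set.mem_image, Finset.mem_coe, Multiset.mem_toFinset, hmem]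
      exact ⟨by rintro ⟨u, hu, rfl⟩; exact hu, fun hx => ⟨x - y, by simpa using hx, by simp⟩⟩
    rw [← Set.ncard_coe_finset, ← Set.ncard_image_of_injective _ (add_right_injective y), himage,
      hcard]
    refine (card_roots' P).trans ?_
    rw [hP, differencePoly, natDegree_sub_C, natDegree_taylor]
  have h2 := two_le_card_roots_lt_one hp.two_le hp1 h.monic_differencePoly (IsAlgClosed.splits _)
    (fun k hk => h.norm_coeff_differencePoly_le hp hp1 hy1 hk) 
    (h.norm_le_one_of_mem_roots ha (n := 0) hy rfl) (by rw [coeff_zero_differencePoly, hy]; simp)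
  rw [← hP] at h2
  obtain ⟨u, hu, hu0⟩ : ∃ u ∈ P.roots.filter (‖·‖ < 1), u ≠ 0 := by
    by_contra! hall
    have hrep := Multiset.eq_replicate_of_mem hall
    have := Multiset.nodup_iff_count_le_one.1 (hnodup.filter (‖·‖ < 1)) 0
    rw [hrep, Multiset.count_replicate_self] at this
    omega
  obtain ⟨hu, hlt⟩ := Multiset.mem_filter.1 hu
  exact ⟨y + u, hmem.1 hu, y, hy, by simpa using hu0, by simpa using hlt⟩

/-- Passing to preimages at least halves the valuation of a suitable difference: at least two of
the differences whose product is `x - x'` lie in the open unit disk. -/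
lemma IsInseparableMod.exists_norm_sub_sq_ge [IsAlgClosed L] {p : ℕ} {f : L[X]}
    (h : IsInseparableMod p f) (hp : p.Prime) (hp1 : ‖(p : L)‖ < 1) {a : L} (ha : ‖a‖ ≤ 1)
    {n : ℕ} {x x' : L} (hx : x ∈ iteratedPreimage f a n) (hx' : x' ∈ iteratedPreimage f a n)
    (hlt : ‖x - x'‖ < 1) :
    ∃ y ∈ iteratedPreimage f a (n + 1), ∃ y' ∈ iteratedPreimage f a (n + 1),
      ‖x - x'‖ ≤ ‖y - y'‖ ^ 2 ∧ ‖y - y'‖ < 1 := by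
  obtain ⟨y, hy⟩ : ∃ y, f.eval y = x := IsAlgClosed.eval_surjective h.natDegree_ne_zero x
  have hyn : y ∈ iteratedPreimage f a (n + 1) := mem_iteratedPreimage_succ.2 (hy.symm ▸ hx)
  have hy1 := h.norm_le_one ha hyn
  have hu1 := h.norm_le_one_of_mem_roots ha hyn hx'
  have hprod := h.norm_eval_sub_eq_prod_roots (y := y) (b := x')
  have h2 := two_le_card_roots_lt_one hp.two_le hp1 h.monic_differencePoly (IsAlgClosed.splits _)
    (fun k hk => h.norm_coeff_differencePoly_le hp hp1 hy1 hk) hu1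
    (by rwa [coeff_zero_differencePoly, hy])
  obtain ⟨u, hu⟩ := Multiset.card_pos_iff_exists_mem.1 (two_pos.trans_le h2)
  obtain ⟨B, hB⟩ := Multiset.exists_cons_of_mem hu
  rw [hB, Multiset.card_cons] at h2
  obtain ⟨v, hv⟩ := Multiset.card_pos_iff_exists_mem.1 (by omega : 0 < B.card)
  obtain ⟨B, rfl⟩ := Multiset.exists_cons_of_mem hv
  have hv : v ∈ (differencePoly f y x').roots.filter (‖·‖ < 1) := by rw [hB]; simp
  rw [Multiset.mem_filter] at hu hv
  have hle : ‖x - x'‖ ≤ ‖u‖ * ‖v‖ := by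
    rw [hy, ← Multiset.filter_add_not (fun u : L => ‖u‖ < 1) (differencePoly f y x').roots, hB,
      Multiset.map_add, Multiset.prod_add, Multiset.map_cons, Multiset.map_cons,
      Multiset.prod_cons, Multiset.prod_cons, ← mul_assoc, mul_assoc] at hprod
    rw [hprod, ← Multiset.prod_add, ← Multiset.map_add]
    refine mul_le_of_le_one_right (by positivity) (prod_map_norm_le_one _ fun b hb => ?_)
    rcases Multiset.mem_add.1 hb with hb | hb
    · have hb : b ∈ (differencePoly f y x').roots.filter (‖·‖ < 1) := by rw [hB]; simp [hb]
      exact hu1 b (Multiset.mem_filter.1 hb).1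
    · exact hu1 b (Multiset.mem_filter.1 hb).1
  rcases le_total ‖u‖ ‖v‖ with huv | huv
  · exact ⟨y + v, h.add_mem_iteratedPreimage hx' hv.1, y, hyn, by
      rw [add_sub_cancel_left, sq]; exact hle.trans (by gcongr), by simpa using hv.2⟩
  · exact ⟨y + u, h.add_mem_iteratedPreimage hx' hu.1, y, hyn, by
      rw [add_sub_cancel_left, sq]; exact hle.trans (by gcongr), by simpa using hu.2⟩

lemma IsInseparableMod.exists_norm_natCast_lt_norm_sub [IsAlgClosed L] {p : ℕ} {f : L[X]}
    (h : IsInseparableMod p f) (hp : p.Prime) (hp1 : ‖(p : L)‖ < 1) {a : L} (ha : ‖a‖ ≤ 1)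
    (hcard : (iteratedPreimage f a 1).ncard = f.natDegree) :
    ∃ n, ∃ x ∈ iteratedPreimage f a n, ∃ x' ∈ iteratedPreimage f a n,
      ‖(p : L)‖ < ‖x - x'‖ ∧ ‖x - x'‖ < 1 := by
  obtain ⟨x₀, hx₀, x₀', hx₀', hpos, hlt⟩ := h.exists_norm_sub_lt_one hp hp1 ha hcard
  have key (t : ℕ) : ∃ x ∈ iteratedPreimage f a (1 + t), ∃ x' ∈ iteratedPreimage f a (1 + t),
      ‖x₀ - x₀'‖ ≤ ‖x - x'‖ ^ 2 ^ t ∧ ‖x - x'‖ < 1 := by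
    induction t with
    | zero => exact ⟨x₀, hx₀, x₀', hx₀', by simp, hlt⟩
    | succ t ih =>
      obtain ⟨x, hx, x', hx', hle, hlt⟩ := ih
      obtain ⟨y, hy, y', hy', hle', hlt'⟩ := h.exists_norm_sub_sq_ge hp hp1 ha hx hx' hlt
      refine ⟨y, hy, y', hy', hle.trans ?_, hlt'⟩
      rw [pow_succ' 2 t, pow_mul]
      exact pow_le_pow_left₀ (norm_nonneg _) hle' _
  obtain ⟨t, ht⟩ := exists_pow_lt_of_lt_one hpos hp1
  obtain ⟨x, hx, x', hx', hle, hlt⟩ := key t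
  refine ⟨1 + t, x, hx, x', hx', ?_, hlt⟩
  refine lt_of_pow_lt_pow_left₀ (2 ^ t) (norm_nonneg _) (lt_of_lt_of_le ?_ hle)
  exact (pow_le_pow_of_le_one (norm_nonneg _) hp1.le Nat.lt_two_pow_self.le).trans_lt ht

end PreimageDifferences

/-! ### Value groups and ramification indices -/

section ValueGroups

lemma mem_valueGroup {F : Type*} [NormedField F] {g : ℝˣ} :
    g ∈ valueGroup F ↔ ∃ z : F, z ≠ 0 ∧ ‖z‖ = g := by
  constructor
  · rintro ⟨z, rfl⟩
    exact ⟨z, z.ne_zero, rfl⟩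
  · rintro ⟨z, hz, h⟩
    exact ⟨Units.mk0 z hz, Units.ext h⟩

/-- The value group of a nonarchimedean local field is generated by the largest absolute value
below `1`, which exists because the open unit disk is compact. -/
lemma exists_valueGroup_eq_zpowers (K : Type*) [NontriviallyNormedField K] [IsUltrametricDist K]
    [LocallyCompactSpace K] :
    ∃ ρ : ℝˣ, (0 : ℝ) < ρ ∧ (ρ : ℝ) < 1 ∧ valueGroup K = Subgroup.zpowers ρ := by
  have : ProperSpace K := ProperSpace.of_locallyCompactSpace K
  have hcomp : IsCompact (Metric.ball (0 : K) 1) :=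
    (isCompact_closedBall (0 : K) 1).of_isClosed_subset (IsUltrametricDist.isClosed_ball 0 1)
      Metric.ball_subset_closedBall
  obtain ⟨π, hπ, hmax⟩ := hcomp.exists_isMaxOn ⟨0, by simp⟩ continuous_norm.continuousOn
  rw [mem_ball_zero_iff] at hπ
  have hmax : ∀ x : K, ‖x‖ < 1 → ‖x‖ ≤ ‖π‖ := fun x hx => hmax (mem_ball_zero_iff.2 hx)
  obtain ⟨x, hx0, hx1⟩ := NormedField.exists_norm_lt_one K
  have hpos : 0 < ‖π‖ := hx0.trans_le (hmax x hx1)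
  have hπ0 : π ≠ 0 := norm_pos_iff.1 hpos
  refine ⟨Units.mk0 ‖π‖ hpos.ne', hpos, hπ, le_antisymm ?_ ?_⟩
  · intro g hg
    obtain ⟨z, hz, hzg⟩ := mem_valueGroup.1 hg
    obtain ⟨n, hn⟩ := exists_mem_Ioc_zpow (norm_pos_iff.2 (inv_ne_zero hz))
      ((one_lt_inv₀ hpos).2 hπ)
    rw [norm_inv, inv_zpow, inv_zpow] at hn
    have hlt : ‖z‖ < ‖π‖ ^ n := (inv_lt_inv₀ (zpow_pos hpos n) (norm_pos_iff.2 hz)).1 hn.1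
    have hle : ‖π‖ ^ (n + 1) ≤ ‖z‖ :=
      (inv_le_inv₀ (norm_pos_iff.2 hz) (zpow_pos hpos (n + 1))).1 hn.2
    have hle' := hmax (z / π ^ n) (by
      rwa [norm_div, norm_zpow, div_lt_one (zpow_pos hpos n)])
    rw [norm_div, norm_zpow, div_le_iff₀ (zpow_pos hpos n), mul_comm,
      ← zpow_add_one₀ hpos.ne'] at hle'
    refine ⟨n + 1, Units.ext ?_⟩
    rw [← hzg, le_antisymm hle' hle]
    simp
  · rw [Subgroup.zpowers_le]
    exact mem_valueGroup.2 ⟨π, hπ0, rfl⟩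

end ValueGroups

section LocalField

variable {K : Type*} [NontriviallyNormedField K] [IsUltrametricDist K] [LocallyCompactSpace K]

lemma norm_algebraMap_algClosure (x : K) : ‖algebraMap K (AlgebraicClosure K) x‖ = ‖x‖ :=
  spectralNorm_extends x

instance isUltrametricDist_algClosure : IsUltrametricDist (AlgebraicClosure K) :=
  IsUltrametricDist.isUltrametricDist_of_forall_norm_add_le_max_norm
    (isNonarchimedean_spectralNorm (K := K) (L := AlgebraicClosure K))

lemma pow_finrank_mem_valueGroup (F : IntermediateField K (AlgebraicClosure K))
    [FiniteDimensional K F] {g : ℝˣ} (hg : g ∈ valueGroup F) :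
    g ^ Module.finrank K F ∈ valueGroup K := by
  obtain ⟨z, hz, hzg⟩ := mem_valueGroup.1 hg
  have hzi : IsIntegral K z := Algebra.IsIntegral.isIntegral z
  obtain ⟨m, hm⟩ := minpoly.degree_dvd hzi
  have hmin : minpoly K (z : AlgebraicClosure K) = minpoly K z :=
    minpoly.algebraMap_eq (algebraMap F (AlgebraicClosure K)).injective z
  have hnorm : (g : ℝ) ^ (minpoly K z).natDegree = ‖(minpoly K z).coeff 0‖ := by
    have h := spectralNorm.spectralNorm_eq_norm_coeff_zero_rpow (K := K)
      (L := AlgebraicClosure K) (z : AlgebraicClosure K)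
    rw [hmin] at h
    rw [← hzg, show ‖z‖ = _ from h, ← Real.rpow_natCast, ← Real.rpow_mul (norm_nonneg _),
      one_div, inv_mul_cancel₀, Real.rpow_one]
    exact_mod_cast (minpoly.natDegree_pos hzi).ne'
  rw [hm, pow_mul]
  refine Subgroup.pow_mem _ (mem_valueGroup.2 ⟨(minpoly K z).coeff 0,
    minpoly.coeff_zero_ne_zero hzi hz, ?_⟩) m
  rw [← hnorm, Units.val_pow_eq_pow_val]

lemma ramificationIndex_ne_zero (F : IntermediateField K (AlgebraicClosure K))
    [FiniteDimensional K F] : ramificationIndex K F ≠ 0 := by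
  obtain ⟨ρ, -, -, hρ⟩ := exists_valueGroup_eq_zpowers K
  have hD : Module.finrank K F ≠ 0 := Module.finrank_pos.ne'
  have hpow : ∀ g : valueGroup F, (g : ℝˣ) ^ Module.finrank K F ∈ Subgroup.zpowers ρ :=
    fun g => hρ ▸ pow_finrank_mem_valueGroup F g.2
  -- raising to the power `[F : K]` embeds `|Fˣ|` into the cyclic group `|Kˣ|`
  let φ : valueGroup F →* Subgroup.zpowers ρ :=
    ((powMonoidHom (Module.finrank K F)).comp (valueGroup F).subtype).codRestrict _ hpow
  have hφ : Function.Injective φ := by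
    intro g g' h
    obtain ⟨z, -, hz⟩ := mem_valueGroup.1 g.2
    obtain ⟨z', -, hz'⟩ := mem_valueGroup.1 g'.2
    have h1 : (g : ℝˣ) ^ Module.finrank K F = (g' : ℝˣ) ^ Module.finrank K F :=
      congrArg Subtype.val h
    have h2 : ‖z‖ ^ Module.finrank K F = ‖z'‖ ^ Module.finrank K F := by
      rw [hz, hz']; exact_mod_cast congrArg Units.val h1
    refine Subtype.ext (Units.ext ?_)
    rw [← hz, ← hz']
    exact (pow_left_inj₀ (norm_nonneg _) (norm_nonneg _) hD).1 h2
  have : IsCyclic (valueGroup F) := isCyclic_of_injective φ hφ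
  obtain ⟨σ, hσ⟩ := IsCyclic.exists_generator (α := valueGroup F)
  have : Group.FG (valueGroup F) := ⟨{σ}, by
    rw [Finset.coe_singleton, ← Subgroup.zpowers_eq_closure, Subgroup.eq_top_iff']; exact hσ⟩
  have hle : (powMonoidHom (α := valueGroup F) (Module.finrank K F)).range ≤
      (valueGroup K).subgroupOf (valueGroup F) := by
    rintro _ ⟨g, rfl⟩
    exact pow_finrank_mem_valueGroup F g.2
  exact ne_zero_of_dvd_ne_zero
    (Subgroup.finiteIndex_range_powMonoidHom_of_fg (valueGroup F) hD).index_ne_zero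
    (Subgroup.index_dvd_of_le hle)

/-- Let `g < 1` have a power in `|Kˣ| = ⟨ρ⟩`, say `g ^ D = ρ ^ t`. If `g` is a `pᵏ`-th power in
`|Fˣ|`, then `pᵏ` divides `t e(F/K)`, so that the exponent of `p` in `e(F/K)` is at least
`k` minus the exponent of `p` in `t`, whatever the finite extension `F`. -/
lemma exists_bound_of_pow_eq (p : ℕ) [Fact p.Prime] {g : ℝˣ} {D : ℕ} (hD : D ≠ 0)
    (hg : g ^ D ∈ valueGroup K) (hg0 : (0 : ℝ) < g) (hg1 : (g : ℝ) < 1) :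
    ∃ c : ℕ, ∀ (F : IntermediateField K (AlgebraicClosure K)) [FiniteDimensional K F] (k : ℕ),
      (∃ b ∈ valueGroup F, g = b ^ p ^ k) → k ≤ padicValNat p (ramificationIndex K F) + c := by
  obtain ⟨ρ, hρ0, hρ1, hρ⟩ := exists_valueGroup_eq_zpowers K
  obtain ⟨t, ht⟩ := Subgroup.mem_zpowers_iff.1 (hρ ▸ hg)
  have ht0 : t ≠ 0 := by
    rintro rfl
    have h1 : (g : ℝ) ^ D = 1 := by
      rw [zpow_zero] at ht
      rw [← Units.val_pow_eq_pow_val, ← ht, Units.val_one]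
    exact (pow_lt_one₀ hg0.le hg1 hD).ne h1
  have hinj : Function.Injective fun n : ℤ => ρ ^ n := by
    intro m n hmn
    have h1 : (ρ : ℝ) ^ m = (ρ : ℝ) ^ n := by exact_mod_cast congrArg Units.val hmn
    exact zpow_right_injective₀ hρ0 hρ1.ne h1
  refine ⟨padicValInt p t, fun F _ k ⟨b, hb, hgb⟩ => ?_⟩
  have he := ramificationIndex_ne_zero F
  obtain ⟨l, hl⟩ := Subgroup.mem_zpowers_iff.1 
    (hρ ▸ (valueGroup K).pow_relIndex_mem hb : b ^ ramificationIndex K F ∈ Subgroup.zpowers ρ)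
  have h1 : l * (p ^ k * D : ℕ) = t * ramificationIndex K F := hinj <| by
    simp only [zpow_mul, hl, ht, zpow_natCast]
    rw [hgb, ← pow_mul, ← pow_mul, ← pow_mul]
    congr 1; ring
  have h2 : p ^ k ∣ t.natAbs * ramificationIndex K F := by
    have h2 := congrArg Int.natAbs h1
    rw [Int.natAbs_mul, Int.natAbs_mul, Int.natAbs_natCast, Int.natAbs_natCast] at h2
    exact ⟨l.natAbs * D, by rw [← h2]; ring⟩
  have h3 := (padicValNat_dvd_iff_le (mul_ne_zero (Int.natAbs_ne_zero.2 ht0) he)).1 h2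
  rw [padicValNat.mul (Int.natAbs_ne_zero.2 ht0) he] at h3
  rw [padicValInt]; omega

omit [IsUltrametricDist K] [LocallyCompactSpace K] in
lemma finiteDimensional_preimageField (f : K[X]) (a : K) (n : ℕ) (h : (preimages f a n).Finite) :
    FiniteDimensional K (preimageField f a n) := by
  have := h.to_subtype
  exact IntermediateField.finiteDimensional_adjoin fun x _ => Algebra.IsIntegral.isIntegral x

omit [LocallyCompactSpace K] in
lemma mem_integers_iff {x : K} : x ∈ integers K ↔ ‖x‖ ≤ 1 := by
  rw [Valuation.mem_valuationSubring_iff]; exact Iff.rfl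

omit [LocallyCompactSpace K] in
lemma norm_natCast_lt_one (p : ℕ) [CharP (IsLocalRing.ResidueField (integers K)) p] :
    ‖(p : K)‖ < 1 := by
  have h1 : IsLocalRing.residue (integers K) (p : integers K) = 0 := by
    rw [map_natCast, CharP.cast_eq_zero]
  by_contra hge
  have hp0 : (p : K) ≠ 0 := fun h0 => hge (by rw [h0, norm_zero]; exact one_pos)
  have hinv : (p : K)⁻¹ ∈ integers K := by
    rw [mem_integers_iff, norm_inv]; exact inv_le_one_of_one_le₀ (not_lt.1 hge)
  have hunit : IsUnit (p : integers K) :=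
    IsUnit.of_mul_eq_one ⟨_, hinv⟩ (Subtype.ext (by simpa using mul_inv_cancel₀ hp0))
  exact (hunit.map (IsLocalRing.residue (integers K))).ne_zero h1

end LocalField

end LocalArboreal

open LocalArboreal in
theorem theorem2 (K : Type*) [NontriviallyNormedField K] [IsUltrametricDist K]
    [LocallyCompactSpace K] [CharZero K]
    (p : ℕ) [Fact p.Prime] [CharP (IsLocalRing.ResidueField (integers K)) p]
    (f : K[X]) (hf_int : ∀ i, f.coeff i ∈ integers K) (hf_monic : f.Monic)
    (hf_pcb : PostcriticallyBounded f) (hf_zero : f.eval 0 = 0)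
    (d : ℕ) (hd : f.natDegree = d) (hpd : p ∣ d)
    (a : K) (ha_int : a ∈ integers K)
    (ha_avoids : Avoids (toCompletedAlgClosure K a)
      (postcriticalSet (f.map (toCompletedAlgClosure K))))
    (h_distinct : ∀ n : ℕ, (preimages f a n).ncard = d ^ n) :
    InfinitelyWildlyRamified p (preimageField f a) := by
  have hp : p.Prime := Fact.out
  have hd0 : d ≠ 0 := by
    rintro rfl
    rw [hf_monic.natDegree_eq_zero] at hd
    simp [hd] at hf_zero
  have : CharZero (AlgebraicClosure K) := charZero_of_injective_algebraMap
    (algebraMap K (AlgebraicClosure K)).injective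
  set ι := algebraMap K (AlgebraicClosure K)
  have hp1 : ‖(p : AlgebraicClosure K)‖ < 1 := by
    rw [← map_natCast ι, norm_algebraMap_algClosure]; exact norm_natCast_lt_one p
  have ha : ‖ι a‖ ≤ 1 := (norm_algebraMap_algClosure a).trans_le (mem_integers_iff.1 ha_int)
  have hdeg : (f.map ι).natDegree = d := by rw [natDegree_map, hd]
  have h : IsInseparableMod p (f.map ι) :=
    isInseparableMod_of_isBounded hp (hf_monic.map ι)
      (fun k => by
        rw [coeff_map, norm_algebraMap_algClosure]; exact mem_integers_iff.1 (hf_int k))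
      (hdeg ▸ hpd) (hdeg ▸ hd0) hf_pcb
  have hfin (n : ℕ) : FiniteDimensional K (preimageField f a n) :=
    finiteDimensional_preimageField f a n
      (Set.finite_of_ncard_ne_zero (h_distinct n ▸ pow_ne_zero n hd0))
  obtain ⟨i, x, hx, x', hx', hgt, hlt⟩ := h.exists_norm_natCast_lt_norm_sub hp hp1 ha
    (((h_distinct 1).trans (pow_one d)).trans hdeg.symm)
  have hpos : 0 < ‖x - x'‖ := (norm_nonneg _).trans_lt hgt
  have hmem (n : ℕ) : iteratedPreimage (f.map ι) (ι a) n ⊆ (preimageField f a n).toSubfield :=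
    IntermediateField.subset_adjoin K _
  -- `|x - x'|` has a power in `|Kˣ|` because `x - x'` lies in the finite extension `K_i`
  obtain ⟨c, hc⟩ := exists_bound_of_pow_eq (K := K) p (g := Units.mk0 ‖x - x'‖ hpos.ne')
    (Module.finrank_pos (R := K) (M := preimageField f a i)).ne'
    (pow_finrank_mem_valueGroup _ (mem_valueGroup.2 ⟨⟨x - x', (preimageField f a i).sub_mem
      (hmem i hx) (hmem i hx')⟩, fun h0 => hpos.ne' (by
        rw [show x - x' = 0 from congrArg Subtype.val h0, norm_zero]), rfl⟩)) hpos hlt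
  refine tendsto_atTop.2 fun b => eventually_atTop.2 ⟨i + (b + c), fun n hn => ?_⟩
  obtain ⟨k, rfl⟩ := Nat.exists_eq_add_of_le (show i ≤ n by omega)
  obtain ⟨z, hz, hxz⟩ := h.exists_norm_sub_eq_pow hp hp1 ha
    (fun n => (preimageField f a n).toSubfield) hmem k i x x' hx hx' hgt
  have hz0 : z ≠ 0 := by
    rintro rfl
    rw [norm_zero, zero_pow (pow_ne_zero k hp.ne_zero)] at hxz
    exact hpos.ne' hxz
  have := hc (preimageField f a (i + k)) k ⟨Units.mk0 ‖z‖ (norm_ne_zero_iff.2 hz0),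
    mem_valueGroup.2 ⟨⟨z, hz⟩, fun h0 => hz0 (congrArg Subtype.val h0), rfl⟩, Units.ext hxz⟩
  omega
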